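/- Let $p\neq 2$ be a prime, let $F/\mathbb{Q}_p$ be a finite unramified extension, and fix an algebraic closure $\overline F$ of $F$. Let $n\ge 0$ and $a_1,\dots,a_n\in F$. For integers $r\ge 1$ and $s_1,\dots,s_n\ge 0$ put $$L_{r,s_1,\dots,s_n}=F\bigl(\zeta_{p^r},a_1^{1/p^{s_1}},\dots,a_n^{1/p^{s_n}}\bigr)\subset\overline F ,$$ where $\zeta_{p^r}$ is any primitive $p^r$-th root of unity and $a_i^{1/p^{s_i}}$ is any $p^{s_i}$-th root of $a_i$ in $\overline F$. Assume that the degree hypothesis $$[L_{r^0,s_1^0,\dots,s_n^0}:F(\zeta_{p^{r^0}})]=p^{\sum_{i=1}^n s_i^0}$$ holds for one tuple of integers $r^0\ge 1$, $s_1^0,\dots,s_n^0\ge 0$ and one choice of the roots. Then for all integers $r\ge 1$ and $s_1,\dots,s_n\ge 0$ such that $s_i=0$ whenever $s_i^0=0$ (so for all $r\ge 1$, $s_1,\dots,s_n\ge 0$ if every $s_i^0$ is positive), and for every choice of the roots, the extension $L_{r,s_1,\dots,s_n}/F$ is totally ramified, i.e. $e(L_{r,s_1,\dots,s_n}\mid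 F)=[L_{r,s_1,\dots,s_n}:F]$, and $$e(L_{r,s_1,\dots,s_n}\mid F)=(p-1)\,p^{\,r-1+\sum_{i=1}^n s_i}.$$ -/

import Mathlib

/-- The ring of integers `𝒪_L` of an algebraic extension `L` of the fraction field of `A`
(`A = ℤ_[p]`, or `A` the ring of integers of a finite extension of `ℚ_[p]`). -/
abbrev LocalIntegers (A L : Type*) [CommRing A] [Field L] [Algebra A L] : Subalgebra A L :=
  integralClosure A L

/-- `e` is the ramification index of `L` over the fraction field of `A`: the ramification index of
the maximal ideal of `𝒪_L` over `A`. (When `A` is the ring of integers of a local field and `L` is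
finite over it, `𝒪_L` has exactly one maximal ideal.) -/
def HasRamificationIndex (A L : Type*) [CommRing A] [Field L] [Algebra A L] (e : ℕ) : Prop :=
  ∀ P : Ideal (LocalIntegers A L), P.IsMaximal → P.ramificationIdx A = e

/-- A finite extension `F` of `ℚ_[p]` is unramified: `e(F | ℚ_[p]) = 1`. -/
def IsUnramifiedPadicField (p : ℕ) [Fact p.Prime] (F : Type*) [Field F] [Algebra ℤ_[p] F] : Prop :=
  HasRamificationIndex ℤ_[p] F 1

/-- For a finite extension `F` of `ℚ_[p]`, a finite extension `L` of `F` is totally ramified: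
`e(L | F) = [L : F]`. -/
def IsTotallyRamifiedOver (p : ℕ) [Fact p.Prime] (F L : Type*) [Field F] [Algebra ℤ_[p] F]
    [Field L] [Algebra F L] : Prop :=
  HasRamificationIndex (LocalIntegers ℤ_[p] F) L (Module.finrank F L)

/-- The field `F(ζ, α₁, …, αₙ)` inside the algebraic closure of `F`, that is `L_{r, s₁, …, sₙ}`
when `ζ` is a primitive `p ^ r`-th root of unity and `αᵢ` is a `p ^ sᵢ`-th root of `aᵢ`. -/
noncomputable def radicalField (F : Type*) [Field F] {n : ℕ} (ζ : AlgebraicClosure F)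
    (α : Fin n → AlgebraicClosure F) : IntermediateField F (AlgebraicClosure F) :=
  IntermediateField.adjoin F (insert ζ (Set.range α))

open Module IntermediateField
open scoped Pointwise

/-! The degree and the ramification are found separately; both rest on an automorphism `c` of the
algebraic closure over `F` with `c ζ = ζ⁻¹`. It exists because `F` is unramified: `p` generates the
maximal ideal of `𝒪_F`, so `F(ζ_{p^R})/F` is totally ramified of full degree `φ(p^R)`
(`hasRamificationIndex_cyclotomic`).

Degree. The hypothesis at one tuple makes the `a_i` with `s_i^0 > 0` independent modulo `p`-th
powers of `F(ζ₀)`, hence of `F` (`powIndependent_of_relfinrank_eq`). For odd `p`, an element of `F`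
that is a `p`-th power in `F(ζ_{p^R})` is already one in `F`
(`exists_pow_eq_of_mem_adjoin_primitiveRoot`). Independence thus passes to `F(ζ_{p^R})`, and if `R`
bounds all `s_i`, Kummer theory yields the degree `p^{∑ s_i}` (`PowIndependent.relfinrank_eq`).
Counting degrees then handles smaller `r`.

Ramification. Let `M = F(ζ_{p^R}, α)` with all `α_i^{p^R}` in `F`. Conjugation by a lift of
complex-conjugation type, namely the restriction of `c`, inverts each `τ` in `Gal(M/F(ζ))`
(`radicalField_gal_relations`). Residue field automorphisms commute, so the image of `τ` there is
its own inverse; as `τ` has odd order, that image is trivial (`smul_sub_mem_of_conj_eq_inv`). So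
`Gal(M/F(ζ))` is all inertia, `M/F` is totally ramified, and so is every subextension. No degree
hypothesis enters here. -/

/-! ### Ramification and inertia for finite ring extensions -/

theorem ramificationIdx_le_finrank (R : Type*) {S : Type*} [CommRing R] [CommRing S] [Algebra R S]
    [IsDomain R] [Module.Finite R S] [Module.Flat R S] (P : Ideal S) [P.IsPrime] :
    P.ramificationIdx R ≤ finrank R S := by
  classical
  have : Fintype ((P.under R).primesOver S) :=
    (Algebra.QuasiFinite.finite_primesOver (P.under R)).fintype
  rw [← Ideal.sum_ramification_inertia_eq_finrank (P.under R) S]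
  refine le_trans ?_ (Finset.single_le_sum (f := fun q : (P.under R).primesOver S ↦
    q.1.ramificationIdx R * q.1.inertiaDeg R) (fun _ _ ↦ Nat.zero_le _)
    (Finset.mem_univ ⟨P, inferInstance, inferInstance⟩))
  exact Nat.le_mul_of_pos_right _ (P.inertiaDeg_pos R)

theorem ramificationIdx_eq_card_of_inertia (N : Type*) (B : Type*) {C : Type*} [CommRing B]
    [CommRing C] [Algebra B C]
    [IsDomain B] [IsDomain C] [Module.Finite B C] [Module.Flat B C] [Group N] [Finite N]
    [MulSemiringAction N C] [IsGaloisGroup N B C] (Q : Ideal C) [Q.IsMaximal]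
    [Finite (B ⧸ Q.under B)] (h : ∀ (τ : N) (x : C), τ • x - x ∈ Q) :
    Q.ramificationIdx B = Nat.card N := by
  have : Algebra.IsIntegral B C := inferInstance
  have : (Q.under B).IsMaximal := inferInstance
  have : Finite (Q.under B).ResidueField := Finite.of_surjective _
    (Q.under B).bijective_algebraMap_quotient_residueField.surjective
  rw [← Ideal.ramificationIdxIn_eq_ramificationIdx (Q.under B) Q N,
    ← Ideal.card_inertia_eq_ramificationIdxIn (G := N) (Q.under B) Q]
  have : Q.inertia N = ⊤ := by
    rw [eq_top_iff]
    exact fun τ _ x ↦ h τ x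
  rw [this, Subgroup.card_top]

/-- As `C` is local, all of `G` acts on its residue field. That field is finite, so its automorphism
group is cyclic, and conjugation becomes trivial there: the image of `τ` equals its inverse, has odd
order, and is therefore `1`. -/
theorem smul_sub_mem_of_conj_eq_inv {A C G : Type*} [CommRing A] [CommRing C] [Algebra A C]
    [Group G] [MulSemiringAction G C] [SMulCommClass G A C] [IsLocalRing C]
    [Finite (C ⧸ IsLocalRing.maximalIdeal C)] {τ c : G} (hc : c * τ * c⁻¹ = τ⁻¹) {m : ℕ}
    (hm : Odd m) (hτ : τ ^ m = 1)
    [(IsLocalRing.maximalIdeal C |>.under A).IsMaximal] (x : C) :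
    τ • x - x ∈ IsLocalRing.maximalIdeal C := by
  set Q := IsLocalRing.maximalIdeal C with hQ
  let p := Q.under A
  have hstab (g : G) : g ∈ MulAction.stabilizer G Q := by
    have : (g • Q).IsMaximal := by
      rw [Ideal.pointwise_smul_eq_comap]
      exact Ideal.comap_isMaximal_of_equiv (MulSemiringAction.toRingEquiv G C g).symm
    exact IsLocalRing.eq_maximalIdeal this
  let _ : Field (A ⧸ p) := Ideal.Quotient.field p
  let _ : Field (C ⧸ Q) := Ideal.Quotient.field Q
  let f : G →* Gal((C ⧸ Q)/(A ⧸ p)) := (Ideal.Quotient.stabilizerHom Q p G).comp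
    ((MonoidHom.id G).codRestrict _ hstab)
  have : Finite (A ⧸ p) := Finite.of_injective _ (algebraMap (A ⧸ p) (C ⧸ Q)).injective
  have hcomm : ∀ a b : Gal((C ⧸ Q)/(A ⧸ p)), a * b = b * a := by
    have : IsCyclic Gal((C ⧸ Q)/(A ⧸ p)) := inferInstance
    exact fun a b ↦ (IsCyclic.isMulCommutative (α := Gal((C ⧸ Q)/(A ⧸ p)))).is_comm.comm a b
  have h1 : f τ = (f τ)⁻¹ := by
    have := congrArg f hc
    rw [map_mul, map_mul, hcomm, ← mul_assoc, ← map_mul, inv_mul_cancel, map_one, one_mul, map_inv]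
        at this
    exact this
  have h2 : f τ ^ m = 1 := by rw [← map_pow, hτ, map_one]
  have h3 : f τ = 1 := by
    obtain ⟨k, rfl⟩ := hm
    have : f τ ^ 2 = 1 := by rw [pow_two]; nth_rw 1 [h1]; simp
    rwa [pow_add, pow_mul, this, one_pow, one_mul, pow_one] at h2
  have h4 := DFunLike.congr_fun h3 (Ideal.Quotient.mk Q x)
  rw [← Ideal.Quotient.mk_eq_mk_iff_sub_mem]
  exact h4

/-- Ramification indices multiply in towers and each is at most the rank, so equality for the
product forces it for each factor. -/
theorem ramificationIdx_eq_finrank_of_tower (A : Type*) {B C : Type*} [CommRing A] [CommRing B]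
    [CommRing C]
    [IsDedekindDomain A] [IsDedekindDomain B] [IsDomain C] [Algebra A B] [Algebra B C]
    [Algebra A C] [IsScalarTower A B C] [FaithfulSMul A B] [FaithfulSMul B C] [FaithfulSMul A C]
    [Module.Finite A B] [Module.Finite B C] (Q : Ideal C) [Q.IsPrime]
    (h : finrank A B * finrank B C ≤ Q.ramificationIdx A) :
    (Q.under B).ramificationIdx A = finrank A B := by
  rw [Ideal.ramificationIdx_tower (Q.under B) Q] at h
  have h1 := ramificationIdx_le_finrank A (Q.under B)
  have h2 := ramificationIdx_le_finrank B Q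
  have h3 := Q.ramificationIdx_pos B
  refine le_antisymm h1 ?_
  by_contra! h4
  nlinarith

/-! ### Total ramification in towers of fields -/

section Fields

variable {A F K M : Type*} [CommRing A] [Field F] [Field K] [Field M]
  [Algebra A F] [Algebra F K] [Algebra F M] [Algebra K M]
  [IsScalarTower F K M] [Algebra A K] [Algebra A M] [IsScalarTower A F K] [IsScalarTower A F M]
  [IsScalarTower A K M]

variable (A K M) in
/-- The inclusion of rings of integers induced by a field extension. -/
abbrev integralClosureAlgebra : Algebra (integralClosure A K) (integralClosure A M) :=
  (IsScalarTower.toAlgHom A K M).mapIntegralClosure.toAlgebra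

attribute [local instance] integralClosureAlgebra

instance : IsScalarTower A (integralClosure A K) (integralClosure A M) :=
  .of_algebraMap_eq' (IsScalarTower.toAlgHom A K M).mapIntegralClosure.comp_algebraMap.symm

instance : IsScalarTower (integralClosure A K) (integralClosure A M) M :=
  .of_algebraMap_eq' rfl

instance : FaithfulSMul (integralClosure A K) (integralClosure A M) := by
  rw [faithfulSMul_iff_algebraMap_injective]
  intro x y hxy
  exact Subtype.ext ((algebraMap K M).injective (congrArg Subtype.val hxy))

variable [IsDedekindDomain A] [IsFractionRing A F] [FiniteDimensional F K]

variable (A F K) in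
theorem finrank_integralClosure : finrank A (integralClosure A K) = finrank F K := by
  have : IsFractionRing (integralClosure A K) K :=
    integralClosure.isFractionRing_of_finite_extension F K
  exact (IsFractionRing.finrank_eq A F (integralClosure A K) K).symm

variable [FiniteDimensional F M] [CharZero F]

omit [IsScalarTower F K M] in
theorem HasRamificationIndex.finrank_bot (h : HasRamificationIndex A M (finrank F M)) :
    HasRamificationIndex A K (finrank F K) := by
  intro P hP
  have : IsDedekindDomain (integralClosure A K) := integralClosure.isDedekindDomain A F K
  have : FaithfulSMul A K := FaithfulSMul.trans A F K
  have : FaithfulSMul A M := FaithfulSMul.trans A F M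
  have : Module.Finite A (integralClosure A K) := IsIntegralClosure.finite A F K _
  have : Module.Finite A (integralClosure A M) := IsIntegralClosure.finite A F M _
  have : Module.Finite (integralClosure A K) (integralClosure A M) :=
    .of_restrictScalars_finite A _ _
  obtain ⟨Q, hQ, hQP⟩ := Ideal.exists_maximal_ideal_liesOver_of_isIntegral
      (S := integralClosure A M) P
  rw [hQP.over, ramificationIdx_eq_finrank_of_tower A Q, finrank_integralClosure A F K]
  rw [h Q hQ, Module.finrank_mul_finrank', finrank_integralClosure A F M]

theorem HasRamificationIndex.finrank_trans [IsGalois K M]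
    (h : HasRamificationIndex A K (finrank F K))
    (hfin : ∀ Q : Ideal (integralClosure A M), Q.IsMaximal → Finite (integralClosure A M ⧸ Q))
    (hinertia : ∀ Q : Ideal (integralClosure A M), Q.IsMaximal → ∀ (τ : Gal(M/K))
    (x : integralClosure A M),
      τ • x - x ∈ Q) : HasRamificationIndex A M (finrank F M) := by
  intro Q hQ
  have : IsDedekindDomain (integralClosure A K) := integralClosure.isDedekindDomain A F K
  have : IsFractionRing (integralClosure A K) K :=
    integralClosure.isFractionRing_of_finite_extension F K
  have : IsFractionRing (integralClosure A M) M :=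
    integralClosure.isFractionRing_of_finite_extension F M
  have : FiniteDimensional K M := .right F K M
  have : Module.Finite A (integralClosure A M) := IsIntegralClosure.finite A F M _
  have : Module.Finite (integralClosure A K) (integralClosure A M) :=
    .of_restrictScalars_finite A _ _
  have : IsGaloisGroup Gal(M/K) (integralClosure A K) (integralClosure A M) :=
    IsGaloisGroup.of_isFractionRing _ _ _ K M
  have hq : (Q.under (integralClosure A K)).IsMaximal := inferInstance
  have := hfin Q hQ
  have : Finite (integralClosure A K ⧸ Q.under (integralClosure A K)) :=
    Finite.of_injective _ (Ideal.algebraMap_quotient_injective (I := Q))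
  rw [Ideal.ramificationIdx_tower (Q.under (integralClosure A K)) Q,
    h _ hq, ramificationIdx_eq_card_of_inertia Gal(M/K) _ Q (hinertia Q hQ),
    IsGalois.card_aut_eq_finrank, finrank_mul_finrank]

end Fields

/-! ### Cyclotomic extensions of `p`-power order -/

/-- `p` is the value at `1` of the cyclotomic polynomial, that is, the product of the `1 - μ` over
primitive roots `μ`. Each `μ` is a power of `ζ`, so `ζ - 1` divides each factor. -/
theorem sub_one_pow_totient_dvd_prime {R : Type*} [CommRing R] [IsDomain R] {p k : ℕ} [Fact p.Prime]
    {ζ : R}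
    (hζ : IsPrimitiveRoot ζ (p ^ (k + 1))) : (ζ - 1) ^ (p ^ (k + 1)).totient ∣ (p : R) := by
  rw [← Polynomial.eval_one_cyclotomic_prime_pow (R := R) k,
    Polynomial.cyclotomic_eq_prod_X_sub_primitiveRoots hζ, Polynomial.eval_prod,
    ← hζ.card_primitiveRoots, ← Finset.prod_const]
  refine Finset.prod_dvd_prod_of_dvd _ _ fun μ hμ ↦ ?_
  have hμ := (mem_primitiveRoots (pow_pos (Fact.out : p.Prime).pos _)).mp hμ
  obtain ⟨i, -, rfl⟩ := hζ.eq_pow_of_pow_eq_one hμ.pow_eq_one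
  simpa [dvd_sub_comm] using sub_one_dvd_pow_sub_one ζ i

theorem le_ramificationIdx_of_pow_dvd {A B : Type*} [CommRing A] [CommRing B] [Algebra A B]
    [IsDedekindDomain B]
    {Q : Ideal B} [Q.IsPrime] {p : A} (hp : Q.under A = Ideal.span {p}) (hp0 : algebraMap A B p ≠ 0)
    {x : B} (hx : x ∈ Q) {n : ℕ} (h : x ^ n ∣ algebraMap A B p) : n ≤ Q.ramificationIdx A := by
  have h0 : (Q.under A).map (algebraMap A B) ≠ ⊥ := by
    rw [hp, Ideal.map_span, Set.image_singleton]
    simpa using hp0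
  have hQ : Q ≠ ⊥ := ne_bot_of_le_ne_bot h0 (Ideal.map_le_of_le_comap le_rfl)
  rw [Ideal.IsDedekindDomain.ramificationIdx_eq_multiplicity (Q.under A) Q h0]
  refine FiniteMultiplicity.le_multiplicity_of_pow_dvd
      (FiniteMultiplicity.of_prime_left (Ideal.prime_of_isPrime hQ inferInstance) h0) ?_
  rw [Ideal.dvd_iff_le, hp, Ideal.map_span, Set.image_singleton, Ideal.span_singleton_le_iff_mem]
  exact Ideal.mem_of_dvd _ h (Ideal.pow_mem_pow hx n)

/-- The chain `φ(p^(k+1)) ≤ e ≤ [K : F] ≤ φ(p^(k+1))` collapses; the first inequality comes from `(ζ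
- 1)^φ ∣ p`. -/
theorem hasRamificationIndex_cyclotomic {A F K : Type*} [CommRing A] [IsDedekindDomain A] [Field F]
    [Field K]
    [Algebra A F] [IsFractionRing A F] [Algebra F K] [Algebra A K] [IsScalarTower A F K]
    [CharZero F]
    [FiniteDimensional F K] {p k : ℕ} [Fact p.Prime] [IsLocalRing A]
    (hA : IsLocalRing.maximalIdeal A = Ideal.span {(p : A)}) {ζ : K}
    (hζ : IsPrimitiveRoot ζ (p ^ (k + 1)))
    (hK : finrank F K ≤ (p ^ (k + 1)).totient) :
    HasRamificationIndex A K (finrank F K) ∧ finrank F K = (p ^ (k + 1)).totient := by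
  have : IsDedekindDomain (integralClosure A K) := integralClosure.isDedekindDomain A F K
  have : FaithfulSMul A K := FaithfulSMul.trans A F K
  have : CharZero A := (algebraMap A F).charZero
  have : CharZero (integralClosure A K) := charZero_of_injective_algebraMap
    (FaithfulSMul.algebraMap_injective A (integralClosure A K))
  have : Module.Finite A (integralClosure A K) := IsIntegralClosure.finite A F K _
  have hp : p.Prime := Fact.out
  let ζ' : integralClosure A K := ⟨ζ, hζ.isIntegral (pow_pos hp.pos _) |>.tower_top⟩
  have hζ' : IsPrimitiveRoot ζ' (p ^ (k + 1)) :=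
    IsPrimitiveRoot.of_map_of_injective (f := (integralClosure A K).val) hζ Subtype.val_injective
  have key (Q : Ideal (integralClosure A K)) (hQ : Q.IsMaximal) :
      (p ^ (k + 1)).totient ≤ Q.ramificationIdx A ∧ Q.ramificationIdx A ≤ finrank F K := by
    have hQA : Q.under A = Ideal.span {(p : A)} := by
      rw [← hA]
      exact IsLocalRing.eq_maximalIdeal inferInstance
    have hpQ : (p : integralClosure A K) ∈ Q := by
      have : (p : A) ∈ Q.under A := by rw [hQA]; exact Ideal.mem_span_singleton_self _
      simpa using Ideal.mem_comap.mp this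
    refine ⟨le_ramificationIdx_of_pow_dvd hQA (x := ζ' - 1) (by simpa using hp.ne_zero) ?_
      (by simpa using sub_one_pow_totient_dvd_prime hζ'), ?_⟩
    · have : CharP (integralClosure A K ⧸ Q) p := by
        let _ := Ideal.Quotient.field Q
        exact ringChar.of_eq (CharP.ringChar_of_prime_eq_zero hp
          (by simpa using Ideal.Quotient.eq_zero_iff_mem.mpr hpQ))
      -- In characteristic `p`, `(ζ - 1)^(p^(k+1)) = ζ^(p^(k+1)) - 1 = 0`, so `ζ - 1` lies in `Q`.
      refine hQ.isPrime.mem_of_pow_mem (p ^ (k + 1)) (Ideal.Quotient.eq_zero_iff_mem.mp ?_)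
      rw [map_pow, map_sub, sub_pow_char_pow, ← map_pow, hζ'.pow_eq_one]
      simp
    · rw [← finrank_integralClosure A F K]
      exact ramificationIdx_le_finrank A Q
  obtain ⟨Q₀, hQ₀⟩ := Ideal.exists_maximal (integralClosure A K)
  have := key Q₀ hQ₀
  refine ⟨fun Q hQ ↦ ?_, by omega⟩
  have := key Q hQ
  omega

/-! ### Rings of integers over `ℤ_[p]` are local with finite residue field -/

theorem isIntegral_padicInt_iff {p : ℕ} [Fact p.Prime] {E : Type*} [Field E] [Algebra ℚ_[p] E]
    [Algebra ℤ_[p] E] [IsScalarTower ℤ_[p] ℚ_[p] E] [FiniteDimensional ℚ_[p] E] (x : E) : IsIntegral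
    ℤ_[p] x ↔ spectralNorm ℚ_[p] E x ≤ 1 := by
  have hx : IsIntegral ℚ_[p] x := Algebra.IsIntegral.isIntegral x
  rw [spectralNorm, spectralValue_le_one_iff (minpoly.monic hx)]
  constructor
  · intro h n
    rw [minpoly.isIntegrallyClosed_eq_field_fractions' ℚ_[p] h, Polynomial.coeff_map]
    exact PadicInt.norm_le_one _
  · intro h
    have hl : minpoly ℚ_[p] x ∈ Polynomial.lifts (algebraMap ℤ_[p] ℚ_[p]) := by
      rw [Polynomial.lifts_iff_coeff_lifts]
      exact fun n ↦ ⟨⟨_, h n⟩, rfl⟩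
    obtain ⟨q, hq, -, hqm⟩ := Polynomial.lifts_and_natDegree_eq_and_monic hl (minpoly.monic hx)
    refine ⟨q, hqm, ?_⟩
    have := minpoly.aeval ℚ_[p] x
    rw [← hq, Polynomial.aeval_map_algebraMap] at this
    exact this

theorem isLocalRing_of_isIntegral_or_inv {A E : Type*} [CommRing A] [Field E] [Algebra A E]
    (h : ∀ x : E, IsIntegral A x ∨ IsIntegral A x⁻¹) : IsLocalRing (integralClosure A E) := by
  have : PreValuationRing (integralClosure A E) := by
    refine ⟨fun a b ↦ ?_⟩
    rcases eq_or_ne b 0 with rfl | hb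
    · exact ⟨0, .inl (mul_zero a)⟩
    rcases eq_or_ne a 0 with rfl | ha
    · exact ⟨0, .inr (mul_zero b)⟩
    have ha' : (a : E) ≠ 0 := fun h ↦ ha (Subtype.ext h)
    have hb' : (b : E) ≠ 0 := fun h ↦ hb (Subtype.ext h)
    rcases h (b / a) with h | h
    · exact ⟨⟨_, h⟩, .inl (Subtype.ext (mul_div_cancel₀ (b : E) ha'))⟩
    · rw [inv_div] at h
      exact ⟨⟨_, h⟩, .inr (Subtype.ext (mul_div_cancel₀ (a : E) hb'))⟩
  have : ValuationRing (integralClosure A E) := {}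
  infer_instance
-- The spectral norm is multiplicative over the complete field `ℚ_[p]`, so `x` and `x⁻¹` cannot both
-- have norm above `1`.
theorem isIntegral_or_inv {p : ℕ} [Fact p.Prime] {E : Type*} [Field E] [Algebra ℚ_[p] E]
    [Algebra ℤ_[p] E] [IsScalarTower ℤ_[p] ℚ_[p] E] [FiniteDimensional ℚ_[p] E] (x : E) : IsIntegral
    ℤ_[p] x ∨ IsIntegral ℤ_[p] x⁻¹ := by
  by_cases hx : x = 0
  · exact .inl (hx ▸ isIntegral_zero)
  rw [isIntegral_padicInt_iff, isIntegral_padicInt_iff, ← spectralMulAlgNorm_def, ←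
      spectralMulAlgNorm_def]
  have : spectralMulAlgNorm ℚ_[p] E x * spectralMulAlgNorm ℚ_[p] E x⁻¹ = 1 := by
    rw [← map_mul, mul_inv_cancel₀ hx, map_one]
  by_contra! h
  nlinarith [h.1, h.2]

/-- The extension of the maximal ideal of `R` is `m ^ e * J` with `J` not inside `m`; locality makes
`J` the unit ideal. -/
theorem maximalIdeal_eq_span_of_ramificationIdx_eq_one {R B : Type*} [CommRing R] [IsDomain R]
    [IsLocalRing R] [CommRing B] [Algebra R B]
   [IsDedekindDomain B] [IsLocalRing B] [FaithfulSMul R B] [Algebra.IsIntegral R B] {x : R}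
       (hx : x ≠ 0) (hm : IsLocalRing.maximalIdeal R = Ideal.span {x})
   (h : (IsLocalRing.maximalIdeal B).ramificationIdx R = 1) : IsLocalRing.maximalIdeal B =
       Ideal.span {algebraMap R B x} := by
  have hu : (IsLocalRing.maximalIdeal B).under R = Ideal.span {x} := by
    rw [← hm]; exact IsLocalRing.eq_maximalIdeal inferInstance
  set m := IsLocalRing.maximalIdeal B
  have h0 : (m.under R).map (algebraMap R B) ≠ ⊥ := by
    rw [hu, Ideal.map_span, Set.image_singleton]
    simpa using hx
  have hm0 : m ≠ ⊥ := ne_bot_of_le_ne_bot h0 (Ideal.map_le_of_le_comap le_rfl)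
  rw [Ideal.IsDedekindDomain.ramificationIdx_eq_multiplicity (m.under R) m h0] at h
  obtain ⟨J, hJ, hJm⟩ := (FiniteMultiplicity.of_prime_left
    (Ideal.prime_of_isPrime hm0 inferInstance) h0).exists_eq_pow_mul_and_not_dvd
  rw [Ideal.dvd_iff_le] at hJm
  have hJ1 : J = ⊤ := by
    by_contra hJ1
    exact hJm (IsLocalRing.le_maximalIdeal hJ1)
  rw [h, hJ1, pow_one, Ideal.mul_top, hu, Ideal.map_span, Set.image_singleton] at hJ
  exact hJ.symm

theorem finite_quotient_of_finite_quotient_under (R : Type*) {S : Type*} [CommRing R] [CommRing S]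
    [Algebra R S] [Module.Finite R S] (Q : Ideal S) [Finite (R ⧸ Q.under R)] : Finite (S ⧸ Q) :=
  have : Module.Finite (R ⧸ Q.under R) (S ⧸ Q) := .of_restrictScalars_finite R _ _
  Module.finite_of_finite (R ⧸ Q.under R)

section Padic
variable {p : ℕ} [Fact p.Prime]
    {F : Type*} [Field F] [Algebra ℚ_[p] F] [FiniteDimensional ℚ_[p] F]
    [Algebra ℤ_[p] F] [IsScalarTower ℤ_[p] ℚ_[p] F]

theorem isLocalRing_localIntegers {M : Type*} [Field M] [Algebra F M] [FiniteDimensional F M]  :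
    IsLocalRing (integralClosure (LocalIntegers ℤ_[p] F) M) := by
  let _ : Algebra ℤ_[p] M := ((algebraMap F M).comp (algebraMap ℤ_[p] F)).toAlgebra
  have : IsScalarTower ℤ_[p] F M := .of_algebraMap_eq' rfl
  let _ : Algebra ℚ_[p] M := ((algebraMap F M).comp (algebraMap ℚ_[p] F)).toAlgebra
  have : IsScalarTower ℚ_[p] F M := .of_algebraMap_eq' rfl
  have : FiniteDimensional ℚ_[p] M := .trans ℚ_[p] F M
  have : IsScalarTower ℤ_[p] ℚ_[p] M := by
    refine .of_algebraMap_eq fun x ↦ ?_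
    rw [IsScalarTower.algebraMap_apply ℤ_[p] F M, IsScalarTower.algebraMap_apply ℤ_[p] ℚ_[p] F]
    rfl
  exact isLocalRing_of_isIntegral_or_inv fun x ↦
    (isIntegral_or_inv (p := p) x).imp IsIntegral.tower_top IsIntegral.tower_top

theorem isLocalRing_localIntegers_base : IsLocalRing (LocalIntegers ℤ_[p] F) :=
  isLocalRing_of_isIntegral_or_inv isIntegral_or_inv

theorem charZero_of_algebra_padic (p : ℕ) [Fact p.Prime] (F : Type*) [Field F] [Algebra ℚ_[p] F] :
    CharZero F :=
  charZero_of_injective_algebraMap (algebraMap ℚ_[p] F).injective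

theorem isDedekindDomain_localIntegers : IsDedekindDomain (LocalIntegers ℤ_[p] F) :=
  have := charZero_of_algebra_padic p F
  integralClosure.isDedekindDomain ℤ_[p] ℚ_[p] F

theorem IsUnramifiedPadicField.maximalIdeal_eq (hF : IsUnramifiedPadicField p F)
    [IsLocalRing (LocalIntegers ℤ_[p] F)] :
    IsLocalRing.maximalIdeal (LocalIntegers ℤ_[p] F) = Ideal.span {(p : LocalIntegers ℤ_[p] F)} :=
        by
  have := charZero_of_algebra_padic p F
  have : IsDedekindDomain (LocalIntegers ℤ_[p] F) := isDedekindDomain_localIntegers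
  have : FaithfulSMul ℤ_[p] F := .trans _ ℚ_[p] _
  simpa using maximalIdeal_eq_span_of_ramificationIdx_eq_one
    (Nat.cast_ne_zero.mpr (Fact.out : p.Prime).ne_zero) PadicInt.maximalIdeal_eq_span_p
    (hF _ inferInstance)

theorem finite_quotient_localIntegers {M : Type*} [Field M] [Algebra F M] [FiniteDimensional F M]
    (Q : Ideal (integralClosure (LocalIntegers ℤ_[p] F) M))
   [hQ : Q.IsMaximal] : Finite (integralClosure (LocalIntegers ℤ_[p] F) M ⧸ Q) := by
  let _ : Algebra ℤ_[p] M := ((algebraMap F M).comp (algebraMap ℤ_[p] F)).toAlgebra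
  have : IsScalarTower ℤ_[p] F M := .of_algebraMap_eq' rfl
  have := charZero_of_algebra_padic p F
  have : IsDedekindDomain (LocalIntegers ℤ_[p] F) := isDedekindDomain_localIntegers
  have : IsFractionRing (LocalIntegers ℤ_[p] F) F :=
    integralClosure.isFractionRing_of_finite_extension ℚ_[p] F
  have : Module.Finite ℤ_[p] (LocalIntegers ℤ_[p] F) := IsIntegralClosure.finite ℤ_[p] ℚ_[p] F _
  have : Module.Finite (LocalIntegers ℤ_[p] F) (integralClosure (LocalIntegers ℤ_[p] F) M) :=
    IsIntegralClosure.finite _ F M _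
  have : Module.Finite ℤ_[p] (integralClosure (LocalIntegers ℤ_[p] F) M) :=
    .trans (LocalIntegers ℤ_[p] F) _
  have hq : Q.under ℤ_[p] = IsLocalRing.maximalIdeal ℤ_[p] :=
    IsLocalRing.eq_maximalIdeal inferInstance
  have : Finite (ℤ_[p] ⧸ Q.under ℤ_[p]) := by
    rw [hq]
    exact Finite.of_equiv _ (PadicInt.residueField (p := p)).symm.toEquiv
  exact finite_quotient_of_finite_quotient_under ℤ_[p] Q

end Padic

/-! ### Kummer theory: from independence to the degree -/

section Kummer

variable {F Ω : Type*} [Field F] [Field Ω] [Algebra F Ω] [Algebra.IsAlgebraic F Ω]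

theorem relfinrank_sup_adjoin_simple (E : IntermediateField F Ω) (b : Ω) :
    E.relfinrank (E ⊔ F⟮b⟯) = (minpoly E b).natDegree := by
  rw [relfinrank_eq_finrank_of_le le_sup_left]
  have : extendScalars (le_sup_left : E ≤ E ⊔ F⟮b⟯) = adjoin E {b} := by
    apply restrictScalars_injective F
    rw [extendScalars_restrictScalars, restrictScalars_adjoin_eq_sup]
  rw [this, adjoin.finrank ((Algebra.IsAlgebraic.isAlgebraic (R := F) b).tower_top E).isIntegral]

theorem relfinrank_sup_adjoin_simple_le {E : IntermediateField F Ω} {b : Ω} {m : ℕ} (hm : 0 < m)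
    (hb : b ^ m ∈ E) : E.relfinrank (E ⊔ F⟮b⟯) ≤ m := by
  rw [relfinrank_sup_adjoin_simple]
  have hmonic := Polynomial.monic_X_pow_sub_C (⟨b ^ m, hb⟩ : E) hm.ne'
  refine (Polynomial.natDegree_le_of_dvd (minpoly.dvd E b ?_) hmonic.ne_zero).trans_eq
    Polynomial.natDegree_X_pow_sub_C
  simp

omit [Algebra.IsAlgebraic F Ω] in
theorem sup_adjoin_image_insert {ι : Type*} [DecidableEq ι] (E : IntermediateField F Ω) (i : ι)
    (S : Finset ι) (b : ι → Ω) :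
    E ⊔ adjoin F (b '' ↑(insert i S)) = (E ⊔ F⟮b i⟯) ⊔ adjoin F (b '' S) := by
  rw [Finset.coe_insert, Set.image_insert_eq, Set.insert_eq, adjoin_union, sup_assoc]

theorem relfinrank_sup_adjoin_le {ι : Type*} {m : ι → ℕ} {b : ι → Ω} (S : Finset ι)
    (E : IntermediateField F Ω)
    (hm : ∀ i ∈ S, 0 < m i) (hb : ∀ i ∈ S, b i ^ m i ∈ E) :
    E.relfinrank (E ⊔ adjoin F (b '' S)) ≤ ∏ i ∈ S, m i := by
  classical
  induction S using Finset.induction_on generalizing E with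
  | empty => simp
  | insert i S hi ih =>
    rw [sup_adjoin_image_insert, ← relfinrank_mul_relfinrank (le_sup_left : E ≤ E ⊔ F⟮b i⟯)
        le_sup_left,
      Finset.prod_insert hi]
    exact Nat.mul_le_mul (relfinrank_sup_adjoin_simple_le (hm i (Finset.mem_insert_self ..))
        (hb i (Finset.mem_insert_self ..)))
      (ih _ (fun j hj ↦ hm j (Finset.mem_insert_of_mem hj))
        fun j hj ↦ (le_sup_left : E ≤ _) (hb j (Finset.mem_insert_of_mem hj)))

omit [Algebra.IsAlgebraic F Ω] in
theorem algEquiv_eq_of_mem_sup_adjoin {E : IntermediateField F Ω} {g₁ g₂ : Gal(Ω/F)} {b : Set Ω}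
    (hE : ∀ x ∈ E, g₁ x = g₂ x) (hb : ∀ x ∈ b, g₁ x = g₂ x) {y : Ω} (hy : y ∈ E ⊔ adjoin F b) : g₁ y
    = g₂ y := by
  let H : IntermediateField F Ω := (AlgHom.equalizer (g₁ : Ω →ₐ[F] Ω) g₂).toIntermediateField (by
    intro x hx
    have hx : g₁ x = g₂ x := hx
    change g₁ x⁻¹ = g₂ x⁻¹
    rw [map_inv₀, map_inv₀, hx])
  have hle : E ⊔ adjoin F b ≤ H := sup_le hE (adjoin_le_iff.mpr hb)
  exact hle hy

variable [IsAlgClosed Ω] [CharZero F]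

theorem mem_of_forall_algEquiv_eq {E : IntermediateField F Ω} {y : Ω}
    (h : ∀ g : Gal(Ω/F), (∀ x ∈ E, g x = x) → g y = y) : y ∈ E := by
  have : IsAlgClosure F Ω := ⟨inferInstance, inferInstance⟩
  have : IsGalois F Ω := {}
  have := InfiniteGalois.fixedField_fixingSubgroup E
  rw [← this]
  rintro ⟨g, hg⟩
  exact h g fun x hx ↦ hg ⟨x, hx⟩

theorem exists_algEquiv_of_irreducible {E : IntermediateField F Ω} {q : Polynomial E}
    (hq : Irreducible q) {x y : Ω}
    (hx : Polynomial.aeval x q = 0) (hy : Polynomial.aeval y q = 0) :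
    ∃ g : Gal(Ω/F), (∀ z ∈ E, g z = z) ∧ g x = y := by
  have : IsAlgClosure E Ω := ⟨inferInstance, Algebra.IsAlgebraic.tower_top (K := F) E⟩
  have : IsGalois E Ω := {}
  have h : IsConjRoot E x y := by
    rw [isConjRoot_def, ← minpoly.eq_of_irreducible hq hx, ← minpoly.eq_of_irreducible hq hy]
  obtain ⟨σ, hσ⟩ := (isConjRoot_iff_exists_algEquiv).mp h.symm
  exact ⟨σ.restrictScalars F, fun z hz ↦ σ.commutes ⟨z, hz⟩, hσ⟩

end Kummer

theorem IsPrimitiveRoot.exists_pow_mul_eq_of_pow_eq {K : Type*} [Field K] {ζ x y : K} {n : ℕ}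
    (hn : 0 < n) (hζ : IsPrimitiveRoot ζ n)
    (h : x ^ n = y ^ n) : ∃ k < n, x = ζ ^ k * y := by
  rcases eq_or_ne y 0 with rfl | hy
  · rw [zero_pow hn.ne'] at h
    exact ⟨0, hn, by simp [pow_eq_zero_iff hn.ne' |>.mp h]⟩
  · have : NeZero n := ⟨hn.ne'⟩
    obtain ⟨k, hk, hk'⟩ := hζ.eq_pow_of_pow_eq_one (ξ := x / y)
      (by rw [div_pow, h, div_self (pow_ne_zero _ hy)])
    exact ⟨k, hk, by rw [hk', div_mul_cancel₀ _ hy]⟩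

/-- No product of powers of the `a i`, `i ∈ S`, is a `p`-th power in `E`, except for the obvious ones. -/
def PowIndependent {F Ω ι : Type*} [Field F] [Field Ω] [Algebra F Ω] (p : ℕ)
    (E : IntermediateField F Ω) (a : ι → Ω) (S : Finset ι) : Prop :=
  ∀ c : ι → ℕ, (∃ b ∈ E, b ^ p = ∏ i ∈ S, a i ^ c i) → ∀ i ∈ S, p ∣ c i

section Kummer

variable {F Ω : Type*} [Field F] [Field Ω] [Algebra F Ω] [Algebra.IsAlgebraic F Ω] [IsAlgClosed Ω]
    [CharZero F] {p : ℕ} [Fact p.Prime]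

/-- The automorphism `σ : α ↦ ζ α` over `E` multiplies both `b` and `α^(p^t)` by `p`-th roots of
unity, so a suitable power of the latter cancels the effect on `b`. Being fixed by `σ` suffices,
since `σ` generates all automorphisms of `E(α)` over `E`. -/
theorem exists_mul_pow_mem {E : IntermediateField F Ω} {t : ℕ} {ζ : Ω}
    (hζ : IsPrimitiveRoot ζ (p ^ (t + 1))) (hζE : ζ ∈ E)
    {α : Ω} {a : E} (hα : α ^ p ^ (t + 1) = a) (hirr : Irreducible
    (Polynomial.X ^ p ^ (t + 1) - Polynomial.C a))
    {b : Ω} (hb : b ∈ E ⊔ F⟮α⟯) (hbp : b ^ p ∈ E) : ∃ j, b * (α ^ p ^ t) ^ j ∈ E := by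
  have hp : p.Prime := Fact.out
  obtain ⟨σ, hσE, hσα⟩ := exists_algEquiv_of_irreducible hirr (x := α) (y := ζ * α)
    (by simp [hα]) (by simp [mul_pow, hζ.pow_eq_one, hα])
  have hη : IsPrimitiveRoot (ζ ^ p ^ t) p := hζ.pow (pow_pos hp.pos _) (pow_succ ..)
  obtain ⟨m, hm, hσb⟩ := hη.exists_pow_mul_eq_of_pow_eq (x := σ b) (y := b) hp.pos
    (by rw [← map_pow, hσE _ hbp])
  refine ⟨p - m, mem_of_forall_algEquiv_eq fun g hg ↦ ?_⟩
  set y := b * (α ^ p ^ t) ^ (p - m) with hy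
  have hσy : σ y = y := by
    rw [hy, map_mul, map_pow, map_pow, hσb, hσα]
    have : (ζ ^ p ^ t) ^ m * (ζ ^ p ^ t) ^ (p - m) = 1 := by
      rw [← pow_add, Nat.add_sub_cancel' hm.le, hη.pow_eq_one]
    rw [mul_pow ζ, mul_pow (ζ ^ _), mul_mul_mul_comm, this, one_mul]
  have hyE : y ∈ E ⊔ F⟮α⟯ := mul_mem hb
    (pow_mem (pow_mem ((le_sup_right : F⟮α⟯ ≤ _) (mem_adjoin_simple_self F α)) _) _)
  -- `g` agrees with `σ ^ k` on `E(α)`: both fix `E` and send `α` to `ζ ^ k * α`.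
  obtain ⟨k, -, hgα⟩ := hζ.exists_pow_mul_eq_of_pow_eq (x := g α) (y := α) (pow_pos hp.pos _)
    (by rw [← map_pow, hα, hg _ a.2])
  have hσkE (k : ℕ) (x) (hx : x ∈ E) : (σ ^ k) x = x := by
    induction k with
    | zero => rfl
    | succ k ih => rw [pow_succ, AlgEquiv.mul_apply, hσE x hx, ih]
  have hσkα (k : ℕ) : (σ ^ k) α = ζ ^ k * α := by
    induction k with
    | zero => simp
    | succ k ih => rw [pow_succ, AlgEquiv.mul_apply, hσα, map_mul, ih, hσkE k ζ hζE]; ring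
  rw [algEquiv_eq_of_mem_sup_adjoin (g₁ := g) (g₂ := σ ^ k)
      (fun x hx ↦ by rw [hg x hx, hσkE k x hx])
    (by rintro _ rfl; rw [hgα, hσkα]) hyE]
  clear hgα
  induction k with
  | zero => rfl
  | succ k ih => rw [pow_succ, AlgEquiv.mul_apply, hσy, ih]

/-- Roots are adjoined one at a time. For odd `p`, `X^(p^s) - a` is irreducible once `a` is not a
`p`-th power. Independence of the remaining `a j` survives over `E(α i)`, because a new `p`-th root
differs from an element of `E` only by a power of a `p`-th root of `a i`. -/
theorem PowIndependent.relfinrank_eq (hp2 : p ≠ 2) {ι : Type*} {s : ι → ℕ} {α a : ι → Ω} {R : ℕ}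
    {ζ : Ω}
    (hζ : IsPrimitiveRoot ζ (p ^ R)) {S : Finset ι} {E : IntermediateField F Ω} (hζE : ζ ∈ E)
    (hs : ∀ i ∈ S, 1 ≤ s i ∧ s i ≤ R) (hα : ∀ i ∈ S, α i ^ p ^ s i = a i) (ha : ∀ i ∈ S, a i ∈ E)
    (h : PowIndependent p E a S) : E.relfinrank (E ⊔ adjoin F (α '' S)) = p ^ ∑ i ∈ S, s i := by
  classical
  have hp : p.Prime := Fact.out
  induction S using Finset.induction_on generalizing E with
  | empty => simp
  | insert i S hi ih =>
    have hiS := Finset.mem_insert_self i S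
    have hSS {j} (hj : j ∈ S) := Finset.mem_insert_of_mem (b := i) hj
    obtain ⟨⟨hs1, hsR⟩, haE, hαi⟩ := And.intro (hs i hiS) (And.intro (ha i hiS) (hα i hiS))
    obtain ⟨t, ht⟩ : ∃ t, s i = t + 1 := ⟨s i - 1, by omega⟩
    have hirr : Irreducible (Polynomial.X ^ p ^ s i - Polynomial.C (⟨a i, haE⟩ : E)) := by
      refine X_pow_sub_C_irreducible_of_prime_pow hp hp2 _ fun b hb ↦ ?_
      have := h (fun j ↦ if j = i then 1 else 0) ⟨b, b.2, ?_⟩ i hiS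
      · simp [hp.ne_one] at this
      · have hb : (b : Ω) ^ p = a i := congrArg Subtype.val hb
        rw [hb, Finset.prod_insert hi, Finset.prod_eq_one]
        · simp
        · intro j hj
          rw [if_neg (ne_of_mem_of_not_mem hj hi), pow_zero]
    have hdeg : E.relfinrank (E ⊔ F⟮α i⟯) = p ^ s i := by
      rw [relfinrank_sup_adjoin_simple, ← minpoly.eq_of_irreducible_of_monic hirr (by simp [hαi])
        (Polynomial.monic_X_pow_sub_C _ (pow_pos hp.pos _).ne'), Polynomial.natDegree_X_pow_sub_C]
    rw [sup_adjoin_image_insert, ← relfinrank_mul_relfinrank (le_sup_left : E ≤ E ⊔ F⟮α i⟯)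
        le_sup_left,
      hdeg, Finset.sum_insert hi, pow_add]
    congr 1
    refine ih ((le_sup_left : E ≤ _) hζE) (fun j hj ↦ hs j (hSS hj)) (fun j hj ↦ hα j (hSS hj))
      (fun j hj ↦ (le_sup_left : E ≤ _) (ha j (hSS hj))) ?_
    rintro c ⟨b, hb, hbc⟩ j hj
    have hζt : IsPrimitiveRoot (ζ ^ p ^ (R - s i)) (p ^ (t + 1)) :=
      hζ.pow (pow_pos hp.pos _) (by rw [← ht, ← pow_add, Nat.sub_add_cancel hsR])
    obtain ⟨k, hk⟩ := exists_mul_pow_mem hζt (pow_mem hζE _) (a := ⟨a i, haE⟩) (by rw [← ht, hαi])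
      (by rwa [← ht]) hb (by rw [hbc]; exact prod_mem fun j hj ↦ pow_mem (ha j (hSS hj)) _)
    -- The factor `(α i ^ p ^ t) ^ k` contributes `a i ^ k` after taking `p`-th powers.
    have := h (fun j ↦ if j = i then k else c j) ⟨_, hk, ?_⟩ j (hSS hj)
    · rwa [if_neg (ne_of_mem_of_not_mem hj hi)] at this
    · rw [Finset.prod_insert hi, if_pos rfl, mul_pow, hbc, ← hαi, ht, mul_comm]
      congr 1
      · ring
      · exact Finset.prod_congr rfl fun j hj ↦ by rw [if_neg (ne_of_mem_of_not_mem hj hi)]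

end Kummer

/-! ### From the degree to independence, and its passage to cyclotomic fields -/

section Kummer

variable {F Ω : Type*} [Field F] [Field Ω] [Algebra F Ω] [Algebra.IsAlgebraic F Ω] {p : ℕ}
    [Fact p.Prime]
  {ι : Type*} {s : ι → ℕ} {α a : ι → Ω} {S : Finset ι}

/-- Otherwise `α j` would have degree at most `p ^ (s j - 1)` over the field of the other roots, and
the total degree would be too small. -/
theorem pow_notMem_of_relfinrank_eq [DecidableEq ι] {E : IntermediateField F Ω}
    (hs : ∀ i ∈ S, 1 ≤ s i)
    (hα : ∀ i ∈ S, α i ^ p ^ s i ∈ E) (h : E.relfinrank (E ⊔ adjoin F (α '' S)) = p ^ ∑ i ∈ S, s i)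
    {j : ι} (hj : j ∈ S) : α j ^ p ^ (s j - 1) ∉ E ⊔ adjoin F (α '' (S.erase j)) := by
  intro hmem
  have hp : p.Prime := Fact.out
  obtain ⟨t, ht⟩ : ∃ t, s j = t + 1 := ⟨s j - 1, by have := hs j hj; omega⟩
  rw [ht, Nat.add_sub_cancel] at hmem
  have h1 := relfinrank_sup_adjoin_le (m := fun i ↦ p ^ s i) (S.erase j) E
      (fun i _ ↦ pow_pos hp.pos _)
    fun i hi ↦ hα i (Finset.mem_of_mem_erase hi)
  have h2 := relfinrank_sup_adjoin_simple_le (pow_pos hp.pos t) hmem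
  rw [Finset.prod_pow_eq_pow_sum] at h1
  have h3 := relfinrank_mul_relfinrank (le_sup_left : E ≤ E ⊔ adjoin F (α '' (S.erase j)))
    (le_sup_left : _ ≤ _ ⊔ F⟮α j⟯)
  have h4 : E ⊔ adjoin F (α '' S) = (E ⊔ adjoin F (α '' (S.erase j))) ⊔ F⟮α j⟯ := by
    rw [← Finset.insert_erase hj, sup_adjoin_image_insert, Finset.erase_insert_eq_erase,
      Finset.erase_idem, sup_right_comm]
  rw [← h4] at h2
  rw [← h4, h, ← Finset.add_sum_erase S s hj, ht] at h3
  have h5 := h3.symm.trans_le (Nat.mul_le_mul h1 h2)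
  rw [← pow_add, Nat.pow_le_pow_iff_right hp.one_lt] at h5
  omega

/-- A relation with `p ∤ c j` would put the `p`-th root `β j` of `a j` in the field generated by the
other roots: both `β j ^ p` and `β j ^ c j` lie there, and Bézout recovers `β j`. -/
theorem powIndependent_of_relfinrank_eq {E : IntermediateField F Ω} {η : Ω}
    (hη : IsPrimitiveRoot η p) (hηE : η ∈ E) (hs : ∀ i ∈ S, 1 ≤ s i)
    (hα : ∀ i ∈ S, α i ^ p ^ s i = a i) (ha : ∀ i ∈ S, a i ∈ E)
    (h : E.relfinrank (E ⊔ adjoin F (α '' S)) = p ^ ∑ i ∈ S, s i) :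
    PowIndependent p E a S := by
  classical
  have hp : p.Prime := Fact.out
  have hnot {j} (hj : j ∈ S) := pow_notMem_of_relfinrank_eq hs
      (fun i hi ↦ by rw [hα i hi]; exact ha i hi) h hj
  rintro c ⟨b, hb, hbc⟩ j hj
  by_contra hcj
  refine hnot hj ?_
  set E' := E ⊔ adjoin F (α '' (S.erase j))
  have hEE' : E ≤ E' := le_sup_left
  let β : ι → Ω := fun i ↦ α i ^ p ^ (s i - 1)
  have hβp (i) (hi : i ∈ S) : β i ^ p = a i := by
    rw [← pow_mul, ← pow_succ, Nat.sub_add_cancel (hs i hi), hα i hi]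
  have hβ0 (i) (hi : i ∈ S) : β i ≠ 0 := fun h0 ↦ hnot hi (by
    change β i ∈ _
    rw [h0]; exact zero_mem _)
  obtain ⟨k, -, hk⟩ := hη.exists_pow_mul_eq_of_pow_eq (x := ∏ i ∈ S, β i ^ c i) (y := b) hp.pos (by
    rw [hbc, ← Finset.prod_pow]
    exact Finset.prod_congr rfl fun i hi ↦ by rw [pow_right_comm, hβp i hi])
  have h1 : β j ^ c j ∈ E' := by
    rw [← Finset.mul_prod_erase S _ hj] at hk
    have h2 : ∏ i ∈ S.erase j, β i ^ c i ∈ E' := prod_mem fun i hi ↦ pow_mem (pow_mem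
      ((le_sup_right : adjoin F (α '' (S.erase j)) ≤ E') (subset_adjoin F _ ⟨i, hi, rfl⟩)) _) _
    have h3 : ∏ i ∈ S.erase j, β i ^ c i ≠ 0 := Finset.prod_ne_zero_iff.mpr fun i hi ↦
      pow_ne_zero _ (hβ0 i (Finset.mem_of_mem_erase hi))
    rw [eq_div_of_mul_eq h3 hk]
    exact div_mem (hEE' (mul_mem (pow_mem hηE k) hb)) h2
  have h2 : β j ^ p ∈ E' := by
    rw [hβp j hj]
    exact hEE' (ha j hj)
  have hcop : IsCoprime (p : ℤ) (c j : ℤ) := Nat.isCoprime_iff_coprime.mpr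
      ((Nat.Prime.coprime_iff_not_dvd hp).mpr hcj)
  obtain ⟨u, v, huv⟩ := hcop
  have h3 : β j = (β j ^ p) ^ u * (β j ^ c j) ^ v := by
    rw [← zpow_natCast, ← zpow_natCast, ← zpow_mul, ← zpow_mul, ← zpow_add₀ (hβ0 j hj),
      mul_comm _ u, mul_comm _ v, huv, zpow_one]
  change β j ∈ E'
  rw [h3]
  exact mul_mem (zpow_mem h2 u) (zpow_mem h1 v)

omit [Algebra.IsAlgebraic F Ω] [Fact p.Prime] in
theorem PowIndependent.mono {E E' : IntermediateField F Ω} {T : Finset ι}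
    (h : PowIndependent p E' a S) (hE : E ≤ E') (hT : T ⊆ S) :
    PowIndependent p E a T := by
  classical
  rintro c ⟨b, hb, hbc⟩ i hi
  have := h (fun j ↦ if j ∈ T then c j else 0) ⟨b, hE hb, ?_⟩ i (hT hi)
  · simpa [hi] using this
  · rw [hbc, ← Finset.prod_subset hT]
    · exact Finset.prod_congr rfl fun j hj ↦ by rw [if_pos hj]
    · intro j _ hj
      rw [if_neg hj, pow_zero]

variable [IsAlgClosed Ω] [CharZero F]

theorem exists_algEquiv_inv_of_finrank_eq {n : ℕ} (hn : 0 < n) {ζ : Ω} (hζ : IsPrimitiveRoot ζ n)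
    (h : finrank F F⟮ζ⟯ = n.totient) :
    ∃ c : Gal(Ω/F), c ζ = ζ⁻¹ := by
  have : IsAlgClosure F Ω := ⟨inferInstance, inferInstance⟩
  have : IsGalois F Ω := {}
  have hint : IsIntegral F ζ := Algebra.IsIntegral.isIntegral ζ
  rw [adjoin.finrank hint] at h
  have : NeZero (n : Ω) := ⟨by
    have : CharZero Ω := charZero_of_injective_algebraMap (algebraMap F Ω).injective
    exact Nat.cast_ne_zero.mpr hn.ne'⟩
  have hroot {ξ : Ω} (hξ : IsPrimitiveRoot ξ n) : Polynomial.aeval ξ (Polynomial.cyclotomic n F) = 0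
      := by
    rw [Polynomial.aeval_def, Polynomial.eval₂_eq_eval_map, Polynomial.map_cyclotomic]
    exact hξ.isRoot_cyclotomic hn
  have hmin : minpoly F ζ = Polynomial.cyclotomic n F :=
    (Polynomial.eq_of_monic_of_dvd_of_natDegree_le (minpoly.monic hint)
    (Polynomial.cyclotomic.monic n F)
      (minpoly.dvd F ζ (hroot hζ)) (by rw [h, Polynomial.natDegree_cyclotomic])).symm
  have hconj : IsConjRoot F ζ⁻¹ ζ := by
    rw [isConjRoot_def, eq_comm]
    refine minpoly.eq_of_irreducible_of_monic (minpoly.irreducible hint) ?_ (minpoly.monic hint)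
    rw [hmin, hroot hζ.inv]
  obtain ⟨c, hc⟩ := isConjRoot_iff_exists_algEquiv.mp hconj
  exact ⟨c, hc⟩

/-- Multiplying `b` by a `p`-th root of unity makes it fixed by `c`. If then `g b' = η^j b'`,
commutation of `g` and `c` on `F(ζ)` gives `η^j = η^(-j)`, so `p ∣ 2j` and `p ∣ j`. -/
theorem exists_pow_eq_of_mem_adjoin_primitiveRoot (hp2 : p ≠ 2) {k : ℕ} {ζ : Ω}
    (hζ : IsPrimitiveRoot ζ (p ^ (k + 1)))
    {c : Gal(Ω/F)} (hc : c ζ = ζ⁻¹) {b : Ω} (hb : b ∈ F⟮ζ⟯)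
    (hbF : b ^ p ∈ (⊥ : IntermediateField F Ω)) :
    ∃ b' ∈ (⊥ : IntermediateField F Ω), b' ^ p = b ^ p := by
  have hp : p.Prime := Fact.out
  obtain ⟨m, hm⟩ : Odd p := hp.odd_of_ne_two hp2
  have hfix (g : Gal(Ω/F)) {x : Ω} (hx : x ∈ (⊥ : IntermediateField F Ω)) : g x = x := by
    obtain ⟨y, rfl⟩ := mem_bot.mp hx
    exact g.commutes y
  have hη : IsPrimitiveRoot (ζ ^ p ^ k) p := hζ.pow (pow_pos hp.pos _) (pow_succ ..)
  set η := ζ ^ p ^ k with hη_def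
  have hηF : η ∈ F⟮ζ⟯ := pow_mem (mem_adjoin_simple_self F ζ) _
  have hcη : c η = η⁻¹ := by rw [hη_def, map_pow, hc, inv_pow]
  obtain ⟨i, -, hi⟩ := hη.exists_pow_mul_eq_of_pow_eq (x := c b) (y := b) hp.pos
    (by rw [← map_pow, hfix _ hbF])
  set b' := η ^ (i * (m + 1)) * b with hb'
  have hη0 : η ≠ 0 := hη.ne_zero hp.ne_zero
  have hb'p : b' ^ p = b ^ p := by
    rw [hb', mul_pow, pow_right_comm, hη.pow_eq_one, one_pow, one_mul]
  have hb'F : b' ∈ F⟮ζ⟯ := mul_mem (pow_mem hηF _) hb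
  have hcb' : c b' = b' := by
    rw [hb', map_mul, map_pow, hcη, hi, ← mul_assoc, inv_pow]
    congr 1
    rw [inv_mul_eq_iff_eq_mul₀ (pow_ne_zero _ hη0), ← pow_add]
    have : i * (m + 1) + i * (m + 1) = i + p * i := by rw [hm]; ring
    rw [this, pow_add, pow_mul, hη.pow_eq_one, one_pow, mul_one]
  refine ⟨b', mem_of_forall_algEquiv_eq fun g _ ↦ ?_, hb'p⟩
  obtain ⟨j, -, hj⟩ := hη.exists_pow_mul_eq_of_pow_eq (x := g b') (y := b') hp.pos
    (by rw [← map_pow, hb'p, hfix _ hbF])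
  obtain ⟨l, -, hl⟩ := hζ.exists_pow_mul_eq_of_pow_eq (x := g ζ) (y := 1) (pow_pos hp.pos _)
    (by rw [← map_pow, hζ.pow_eq_one, map_one, one_pow])
  rw [mul_one] at hl
  have hcomm : (g * c) b' = (c * g) b' := by
    refine algEquiv_eq_of_mem_sup_adjoin (E := ⊥) (b := {ζ})
        (fun x hx ↦ by rw [hfix _ hx, hfix _ hx])
      ?_ ((le_sup_right : F⟮ζ⟯ ≤ _) hb'F)
    rintro _ rfl
    rw [AlgEquiv.mul_apply, AlgEquiv.mul_apply, hc, hl, map_pow, hc, map_inv₀, hl, inv_pow]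
  rw [AlgEquiv.mul_apply, AlgEquiv.mul_apply, hcb', hj, map_mul, hcb', map_pow, hcη] at hcomm
  rw [hj]
  rcases eq_or_ne b' 0 with h0 | h0
  · rw [h0, mul_zero]
  have h2 := mul_right_cancel₀ h0 hcomm
  rw [inv_pow, ← mul_eq_one_iff_eq_inv₀ (pow_ne_zero _ hη0), ← pow_add, hη.pow_eq_one_iff_dvd, ←
      two_mul] at h2
  have h3 : p ∣ j := ((Nat.coprime_primes hp Nat.prime_two).mpr hp2).dvd_of_dvd_mul_left h2
  rw [(hη.pow_eq_one_iff_dvd j).mpr h3, one_mul]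

theorem PowIndependent.adjoin_primitiveRoot (h : PowIndependent p (⊥ : IntermediateField F Ω) a S)
    (ha : ∀ i ∈ S, a i ∈ (⊥ : IntermediateField F Ω))
    (hp2 : p ≠ 2) {k : ℕ} {ζ : Ω} (hζ : IsPrimitiveRoot ζ (p ^ (k + 1)))
    {c : Gal(Ω/F)} (hc : c ζ = ζ⁻¹) : PowIndependent p F⟮ζ⟯ a S := by
  rintro e ⟨b, hb, hbe⟩
  have hbF : b ^ p ∈ (⊥ : IntermediateField F Ω) := by
    rw [hbe]
    exact prod_mem fun i hi ↦ pow_mem (ha i hi) _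
  obtain ⟨b', hb', hbb'⟩ := exists_pow_eq_of_mem_adjoin_primitiveRoot hp2 hζ hc hb hbF
  exact h e ⟨b', hb', hbb'.trans hbe⟩

end Kummer

theorem finrank_adjoin_primitiveRoot_le {F Ω : Type*} [Field F] [Field Ω] [Algebra F Ω] {n : ℕ}
    (hn : 0 < n) {ζ : Ω}
    (hζ : IsPrimitiveRoot ζ n) : finrank F F⟮ζ⟯ ≤ n.totient := by
  have hint : IsIntegral F ζ := (hζ.isIntegral hn).tower_top
  rw [adjoin.finrank hint, ← Polynomial.natDegree_cyclotomic n F]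
  refine Polynomial.natDegree_le_of_dvd (minpoly.dvd F ζ ?_) (Polynomial.cyclotomic_ne_zero n F)
  rw [Polynomial.aeval_def, Polynomial.eval₂_eq_eval_map, Polynomial.map_cyclotomic]
  exact hζ.isRoot_cyclotomic hn

/-! ### Galois structure of radical extensions -/

section Radical

variable {F : Type*} [Field F] {n : ℕ} {ζ : AlgebraicClosure F} {α : Fin n → AlgebraicClosure F}

theorem radicalField_eq_sup (S : Finset (Fin n)) (h : ∀ i ∉ S, α i ∈
    (⊥ : IntermediateField F (AlgebraicClosure F))) :
    radicalField F ζ α = F⟮ζ⟯ ⊔ adjoin F (α '' S) := by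
  rw [radicalField, Set.insert_eq, adjoin_union]
  apply le_antisymm
  · refine sup_le_sup_left (adjoin_le_iff.mpr ?_) _
    rintro _ ⟨i, rfl⟩
    by_cases hi : i ∈ S
    · exact subset_adjoin F _ ⟨i, hi, rfl⟩
    · exact (bot_le : _ ≤ adjoin F (α '' S)) (h i hi)
  · exact sup_le_sup_left (adjoin.mono F _ _ (Set.image_subset_range α S)) _

variable {N : ℕ} [CharZero F]

instance : FiniteDimensional F (radicalField F ζ α) :=
  have := (Set.finite_range α).insert ζ |>.to_subtype
  finiteDimensional_adjoin fun x _ ↦ Algebra.IsIntegral.isIntegral x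

theorem isGalois_radicalField (hN : 0 < N) (hζ : IsPrimitiveRoot ζ N)
    (hα : ∀ i, α i ^ N ∈ (⊥ : IntermediateField F (AlgebraicClosure F))) : IsGalois F
    (radicalField F ζ α) := by
  have hnormal : Normal F (radicalField F ζ α) := by
    rw [normal_iff_forall_map_le]
    intro σ
    have hζM : ζ ∈ radicalField F ζ α := subset_adjoin F _ (Set.mem_insert ..)
    rw [radicalField, adjoin_map, adjoin_le_iff]
    rintro _ ⟨x, hx, rfl⟩
    have hxM : x ∈ radicalField F ζ α := subset_adjoin F _ hx
    have hxN : x ^ N ∈ (⊥ : IntermediateField F (AlgebraicClosure F)) := by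
      rcases hx with rfl | ⟨i, rfl⟩
      · rw [hζ.pow_eq_one]; exact one_mem _
      · exact hα i
    obtain ⟨y, hy⟩ := mem_bot.mp hxN
    obtain ⟨k, -, hk⟩ := hζ.exists_pow_mul_eq_of_pow_eq (x := σ x) (y := x) hN
      (by rw [← map_pow, ← hy, AlgHom.commutes])
    change σ x ∈ radicalField F ζ α
    rw [hk]
    exact mul_mem (pow_mem hζM k) hxM
  exact {}

/-- Kummer theory makes `Gal(M/F(ζ))` a group of `N`-th roots of unity in each coordinate, with `c`
acting by inversion. Concretely, `σ c σ` and `c` agree on `ζ` and on every `α i`, whatever `c` does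
to the `α i`. -/
theorem radicalField_gal_relations (hN : 0 < N) (hζ : IsPrimitiveRoot ζ N)
    (hα : ∀ i, α i ^ N ∈ (⊥ : IntermediateField F (AlgebraicClosure F)))
    {c : Gal(AlgebraicClosure F/F)} (hc : c ζ = ζ⁻¹) [Normal F (radicalField F ζ α)]
    {τ : Gal(radicalField F ζ α/F)}
    (hτ : ∀ x : radicalField F ζ α, (x : AlgebraicClosure F) = ζ → τ x = x) :
    τ ^ N = 1 ∧ ∃ c : Gal(radicalField F ζ α/F), c * τ * c⁻¹ = τ⁻¹ := by
  let M := radicalField F ζ α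
  have hζM : ζ ∈ M := subset_adjoin F _ (Set.mem_insert ..)
  let f := AlgEquiv.restrictNormalHom (F := F) (K₁ := AlgebraicClosure F) M
  obtain ⟨σ, hσ⟩ : ∃ σ, f σ = τ := AlgEquiv.restrictNormalHom_surjective _ τ
  have hf (g : Gal(AlgebraicClosure F/F)) (x : M) : ((f g) x : AlgebraicClosure F) = g x :=
    AlgEquiv.restrictNormal_commutes g M x
  have hext {g₁ g₂ : Gal(AlgebraicClosure F/F)} (h : ∀ x ∈ insert ζ (Set.range α), g₁ x = g₂ x) : f
      g₁ = f g₂ := by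
    ext x
    rw [hf, hf]
    refine algEquiv_eq_of_mem_sup_adjoin (E := ⊥) (fun y hy ↦ ?_) h ((le_sup_right : M ≤ _) x.2)
    obtain ⟨z, rfl⟩ := mem_bot.mp hy
    rw [AlgEquiv.commutes, AlgEquiv.commutes]
  have hτζ : σ ζ = ζ := by
    have := congrArg Subtype.val (hτ ⟨ζ, hζM⟩ rfl)
    rwa [← hσ, hf] at this
  have hgα (g : Gal(AlgebraicClosure F/F)) (i : Fin n) : ∃ k, g (α i) = ζ ^ k * α i := by
    obtain ⟨y, hy⟩ := mem_bot.mp (hα i)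
    obtain ⟨k, -, hk⟩ := hζ.exists_pow_mul_eq_of_pow_eq (x := g (α i)) (y := α i) hN
      (by rw [← map_pow, ← hy, AlgEquiv.commutes])
    exact ⟨k, hk⟩
  constructor
  · rw [← hσ, ← map_pow, ← map_one f]
    apply hext
    rintro x (hx | ⟨i, rfl⟩)
    · have (m : ℕ) : (σ ^ m) ζ = ζ := by
        induction m with
        | zero => rfl
        | succ m ih => rw [pow_succ, AlgEquiv.mul_apply, hτζ, ih]
      rw [hx, this N, AlgEquiv.one_apply]
    · obtain ⟨k, hk⟩ := hgα σ i
      have (m : ℕ) : (σ ^ m) (α i) = (ζ ^ k) ^ m * α i := by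
        induction m with
        | zero => simp
        | succ m ih =>
          rw [pow_succ', AlgEquiv.mul_apply, ih, map_mul, map_pow, map_pow, hτζ, hk]
          ring
      rw [this N, pow_right_comm, hζ.pow_eq_one, one_pow, one_mul, AlgEquiv.one_apply]
  · have : f (σ * c * σ) = f c := by
      apply hext
      rintro _ (rfl | ⟨i, rfl⟩)
      · simp only [AlgEquiv.mul_apply, hτζ, hc, map_inv₀]
      · obtain ⟨k, hk⟩ := hgα σ i
        obtain ⟨l, hl⟩ := hgα c i
        have h0 : ζ ≠ 0 := hζ.ne_zero hN.ne'
        simp only [AlgEquiv.mul_apply, hk, hl, map_mul, map_pow, hc, hτζ, map_inv₀, inv_pow]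
        field_simp
    refine ⟨f c, ?_⟩
    rw [map_mul, map_mul, hσ] at this
    rw [mul_inv_eq_iff_eq_mul, eq_inv_mul_iff_mul_eq, ← mul_assoc, this]

end Radical

/-! ### Total ramification over an unramified base -/

section Ramified

variable {p : ℕ} [Fact p.Prime] {F : Type*} [Field F] [Algebra ℚ_[p] F] [FiniteDimensional ℚ_[p] F]
  [Algebra ℤ_[p] F] [IsScalarTower ℤ_[p] ℚ_[p] F]

theorem isFractionRing_localIntegers : IsFractionRing (LocalIntegers ℤ_[p] F) F :=
  integralClosure.isFractionRing_of_finite_extension ℚ_[p] F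

theorem IsUnramifiedPadicField.isTotallyRamifiedOver_cyclotomic (hF : IsUnramifiedPadicField p F)
    {Ω : Type*} [Field Ω] [Algebra F Ω]
    {k : ℕ} {ζ : Ω} (hζ : IsPrimitiveRoot ζ (p ^ (k + 1))) :
    IsTotallyRamifiedOver p F F⟮ζ⟯ ∧ finrank F F⟮ζ⟯ = (p ^ (k + 1)).totient := by
  have := charZero_of_algebra_padic p F
  have hp : p.Prime := Fact.out
  have : IsLocalRing (LocalIntegers ℤ_[p] F) := isLocalRing_localIntegers_base
  have : IsDedekindDomain (LocalIntegers ℤ_[p] F) := isDedekindDomain_localIntegers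
  have : IsFractionRing (LocalIntegers ℤ_[p] F) F := isFractionRing_localIntegers
  have hint : IsIntegral F ζ := (hζ.isIntegral (pow_pos hp.pos _)).tower_top
  have : FiniteDimensional F F⟮ζ⟯ := adjoin.finiteDimensional hint
  have hgen : IsPrimitiveRoot (AdjoinSimple.gen F ζ) (p ^ (k + 1)) :=
    .of_map_of_injective (f := F⟮ζ⟯.val) hζ Subtype.val_injective
  exact hasRamificationIndex_cyclotomic hF.maximalIdeal_eq hgen
    (finrank_adjoin_primitiveRoot_le (pow_pos hp.pos _) hζ)

theorem IsTotallyRamifiedOver.of_le {Ω : Type*} [Field Ω] [Algebra F Ω]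
    {L M : IntermediateField F Ω} [FiniteDimensional F M] (hLM : L ≤ M)
    (hM : IsTotallyRamifiedOver p F M) : IsTotallyRamifiedOver p F L := by
  have := charZero_of_algebra_padic p F
  have : IsDedekindDomain (LocalIntegers ℤ_[p] F) := isDedekindDomain_localIntegers
  have : IsFractionRing (LocalIntegers ℤ_[p] F) F := isFractionRing_localIntegers
  let _ : Algebra L M := (inclusion hLM).toAlgebra
  have : IsScalarTower F L M := .of_algebraMap_eq' rfl
  have : IsScalarTower (LocalIntegers ℤ_[p] F) L M := .of_algebraMap_eq' rfl
  have : FiniteDimensional F L := .left F L M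
  exact HasRamificationIndex.finrank_bot (F := F) hM

theorem IsUnramifiedPadicField.isTotallyRamifiedOver_radicalField (hF : IsUnramifiedPadicField p F)
    (hp2 : p ≠ 2) {k n : ℕ}
    {ζ : AlgebraicClosure F} (hζ : IsPrimitiveRoot ζ (p ^ (k + 1))) {α : Fin n → AlgebraicClosure F}
    (hα : ∀ i, α i ^ p ^ (k + 1) ∈ (⊥ : IntermediateField F (AlgebraicClosure F))) :
    IsTotallyRamifiedOver p F (radicalField F ζ α) := by
  have := charZero_of_algebra_padic p F
  have hp : p.Prime := Fact.out
  have : IsDedekindDomain (LocalIntegers ℤ_[p] F) := isDedekindDomain_localIntegers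
  have : IsFractionRing (LocalIntegers ℤ_[p] F) F := isFractionRing_localIntegers
  set M := radicalField F ζ α with hM
  have hζM : F⟮ζ⟯ ≤ M := adjoin_simple_le_iff.mpr (subset_adjoin F _ (Set.mem_insert ..))
  let _ : Algebra F⟮ζ⟯ M := (inclusion hζM).toAlgebra
  have : IsScalarTower F F⟮ζ⟯ M := .of_algebraMap_eq' rfl
  have : IsScalarTower (LocalIntegers ℤ_[p] F) F⟮ζ⟯ M := .of_algebraMap_eq' rfl
  have : FiniteDimensional F M := inferInstance
  have : FiniteDimensional F F⟮ζ⟯ := .left F F⟮ζ⟯ M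
  have : IsGalois F M := isGalois_radicalField (pow_pos hp.pos _) hζ hα
  have : IsGalois F⟮ζ⟯ M := .tower_top_of_isGalois F F⟮ζ⟯ M
  have : IsLocalRing (integralClosure (LocalIntegers ℤ_[p] F) M) := isLocalRing_localIntegers
  obtain ⟨hcyc, hdeg⟩ := hF.isTotallyRamifiedOver_cyclotomic hζ
  obtain ⟨c, hc⟩ := exists_algEquiv_inv_of_finrank_eq (pow_pos hp.pos _) hζ hdeg
  refine HasRamificationIndex.finrank_trans (F := F) (K := F⟮ζ⟯) hcyc
    (fun Q hQ ↦ finite_quotient_localIntegers Q) fun Q hQ τ x ↦ ?_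
  obtain rfl := IsLocalRing.eq_maximalIdeal hQ
  have := finite_quotient_localIntegers (IsLocalRing.maximalIdeal
      (integralClosure (LocalIntegers ℤ_[p] F) M))
  obtain ⟨hτ, c', hc'⟩ := radicalField_gal_relations (pow_pos hp.pos _) hζ hα hc
      (τ := τ.restrictScalars F) (by
    rintro x hx
    have : x = algebraMap F⟮ζ⟯ M (AdjoinSimple.gen F ζ) := Subtype.ext hx
    rw [this]
    exact τ.commutes _)
  exact smul_sub_mem_of_conj_eq_inv (A := LocalIntegers ℤ_[p] F) hc' ((hp.odd_of_ne_two hp2).pow) hτ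
      x

end Ramified

/-! ### The degree for arbitrary exponents -/

section Degree

variable {p : ℕ} [Fact p.Prime] {F : Type*} [Field F] [Algebra ℚ_[p] F] [FiniteDimensional ℚ_[p] F]
  [Algebra ℤ_[p] F] [IsScalarTower ℤ_[p] ℚ_[p] F]

theorem finrank_radicalField_of_le (hF : IsUnramifiedPadicField p F) (hp2 : p ≠ 2) {n : ℕ}
    {a : Fin n → AlgebraicClosure F} {s : Fin n → ℕ} {k : ℕ} {ζ : AlgebraicClosure F}
    (hζ : IsPrimitiveRoot ζ (p ^ (k + 1)))
    {α : Fin n → AlgebraicClosure F} (ha : ∀ i, a i ∈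
    (⊥ : IntermediateField F (AlgebraicClosure F)))
    (hα : ∀ i, α i ^ p ^ s i = a i) (hs : ∀ i, s i ≤ k + 1)
    (hind : PowIndependent p (⊥ : IntermediateField F (AlgebraicClosure F)) a {i | 1 ≤ s i}) :
    finrank F (radicalField F ζ α) = (p ^ (k + 1)).totient * p ^ ∑ i, s i := by
  have := charZero_of_algebra_padic p F
  have hp : p.Prime := Fact.out
  obtain ⟨-, hdeg⟩ := hF.isTotallyRamifiedOver_cyclotomic hζ
  obtain ⟨c, hc⟩ := exists_algEquiv_inv_of_finrank_eq (pow_pos hp.pos _) hζ hdeg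
  have h1 := (hind.adjoin_primitiveRoot (fun i _ ↦ ha i) hp2 hζ hc).relfinrank_eq hp2 hζ (s := s)
      (α := α)
    (mem_adjoin_simple_self F ζ) (fun i hi ↦ ⟨(Finset.mem_filter.mp hi).2, hs i⟩) (fun i _ ↦ hα i)
    (fun i _ ↦ (bot_le : _ ≤ F⟮ζ⟯) (ha i))
  rw [radicalField_eq_sup (Finset.univ.filter fun i ↦ 1 ≤ s i), ← relfinrank_bot_left,
    ← relfinrank_mul_relfinrank bot_le (le_sup_left : F⟮ζ⟯ ≤ _), h1, relfinrank_bot_left, hdeg]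
  · congr 2
    exact Finset.sum_filter_of_ne fun i _ hi ↦ Nat.one_le_iff_ne_zero.mpr hi
  · intro i hi
    have : s i = 0 := by simpa using hi
    have h2 := hα i
    rw [this, pow_zero, pow_one] at h2
    rw [h2]
    exact ha i

/-- If `k + 1` is smaller than some `s i`, Kummer theory does not apply over `F(ζ)`. It does over
`F(ξ)`, and the tower `F(ζ) ⊆ F(ζ, α) ⊆ F(ξ, α)` has steps of degree at most `p^(∑ s i)` and `p^m`
with product `p^(m + ∑ s i)`, so both bounds are attained. -/
theorem finrank_radicalField (hF : IsUnramifiedPadicField p F) (hp2 : p ≠ 2) {n : ℕ}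
    {a : Fin n → AlgebraicClosure F} {s : Fin n → ℕ} {k : ℕ} {ζ : AlgebraicClosure F}
    (hζ : IsPrimitiveRoot ζ (p ^ (k + 1)))
    {α : Fin n → AlgebraicClosure F} (ha : ∀ i, a i ∈
    (⊥ : IntermediateField F (AlgebraicClosure F)))
    (hα : ∀ i, α i ^ p ^ s i = a i)
    (hind : PowIndependent p (⊥ : IntermediateField F (AlgebraicClosure F)) a {i | 1 ≤ s i})
    {m : ℕ} {ξ : AlgebraicClosure F} (hξ : IsPrimitiveRoot ξ (p ^ (k + m + 1)))
    (hs : ∀ i, s i ≤ k + m + 1) :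
    finrank F (radicalField F ζ α) = (p ^ (k + 1)).totient * p ^ ∑ i, s i := by
  have := charZero_of_algebra_padic p F
  have hp : p.Prime := Fact.out
  have hM := finrank_radicalField_of_le hF hp2 hξ ha hα hs hind
  obtain ⟨-, hdeg⟩ := hF.isTotallyRamifiedOver_cyclotomic hζ
  have hsup (ζ : AlgebraicClosure F) : radicalField F ζ α = F⟮ζ⟯ ⊔ adjoin F
      (α '' (Finset.univ : Finset (Fin n))) :=
    radicalField_eq_sup _ (by simp)
  have hζK : F⟮ζ⟯ ≤ radicalField F ζ α := by rw [hsup]; exact le_sup_left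
  have hξζ : ξ ^ p ^ m ∈ F⟮ζ⟯ := by
    obtain ⟨j, -, hj⟩ := hζ.exists_pow_mul_eq_of_pow_eq (x := ξ ^ p ^ m) (y := 1) (pow_pos hp.pos _)
        (by
      rw [← pow_mul, ← pow_add, one_pow, ← hξ.pow_eq_one]
      congr 2
      ring)
    rw [hj, mul_one]
    exact pow_mem (mem_adjoin_simple_self F ζ) j
  have hζξ : F⟮ζ⟯ ≤ F⟮ξ⟯ := by
    rw [adjoin_simple_le_iff]
    obtain ⟨j, -, hj⟩ := hξ.exists_pow_mul_eq_of_pow_eq (x := ζ) (y := 1) (pow_pos hp.pos _) (by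
      rw [show k + m + 1 = k + 1 + m by ring, pow_add, pow_mul, hζ.pow_eq_one, one_pow, one_pow])
    rw [hj, mul_one]
    exact pow_mem (mem_adjoin_simple_self F ξ) j
  have hLM : radicalField F ξ α = radicalField F ζ α ⊔ F⟮ξ⟯ := by
    rw [hsup, hsup, sup_right_comm, sup_eq_right.mpr hζξ]
  have h1 : F⟮ζ⟯.relfinrank (radicalField F ζ α) ≤ p ^ ∑ i, s i := by
    rw [hsup, ← Finset.prod_pow_eq_pow_sum]
    exact relfinrank_sup_adjoin_le _ _ (fun i _ ↦ pow_pos hp.pos _)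
      fun i _ ↦ by rw [hα i]; exact (bot_le : _ ≤ F⟮ζ⟯) (ha i)
  have h2 : (radicalField F ζ α).relfinrank (radicalField F ξ α) ≤ p ^ m := by
    rw [hLM]
    exact relfinrank_sup_adjoin_simple_le (pow_pos hp.pos m) (hζK hξζ)
  have h3 : finrank F (radicalField F ζ α) = (p ^ (k + 1)).totient * F⟮ζ⟯.relfinrank
      (radicalField F ζ α) := by
    rw [← hdeg, ← relfinrank_bot_left, ← relfinrank_bot_left, relfinrank_mul_relfinrank bot_le hζK]
  have h4 : finrank F (radicalField F ζ α) * (radicalField F ζ α).relfinrank (radicalField F ξ α) =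
      finrank F (radicalField F ξ α) := by
    rw [← relfinrank_bot_left, ← relfinrank_bot_left, relfinrank_mul_relfinrank bot_le]
    rw [hLM]
    exact le_sup_left
  have h5 : (p ^ (k + m + 1)).totient = (p ^ (k + 1)).totient * p ^ m := by
    rw [Nat.totient_prime_pow_succ hp, Nat.totient_prime_pow_succ hp, pow_add]
    ring
  rw [hM, h3, h5] at h4
  have hpos : 0 < (p ^ (k + 1)).totient := Nat.totient_pos.mpr (pow_pos hp.pos _)
  rw [h3]
  congr 1
  refine le_antisymm h1 ?_
  have h6 : (p ^ (k + 1)).totient * p ^ m * p ^ ∑ i, s i ≤ (p ^ (k + 1)).totient * p ^ m *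
      F⟮ζ⟯.relfinrank (radicalField F ζ α) := by
    rw [← h4, mul_right_comm]
    exact Nat.mul_le_mul_right _ (Nat.mul_le_mul_left _ h2) |>.trans_eq' (by ring)
  exact Nat.le_of_mul_le_mul_left h6 (Nat.mul_pos hpos (pow_pos hp.pos m))

end Degree

theorem mainTheorem9 (p : ℕ) [Fact p.Prime] (hp : p ≠ 2)
    (F : Type*) [Field F] [Algebra ℚ_[p] F] [FiniteDimensional ℚ_[p] F]
    [Algebra ℤ_[p] F] [IsScalarTower ℤ_[p] ℚ_[p] F]
    (hF : IsUnramifiedPadicField p F)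
    (n : ℕ) (a : Fin n → F)
    -- the degree hypothesis on `a₁, …, aₙ`, at one tuple of exponents `(r₀, s₀)`
    (r₀ : ℕ) (hr₀ : 1 ≤ r₀) (s₀ : Fin n → ℕ)
    (ζ₀ : AlgebraicClosure F) (hζ₀ : IsPrimitiveRoot ζ₀ (p ^ r₀))
    (α₀ : Fin n → AlgebraicClosure F)
    (hα₀ : ∀ i, α₀ i ^ p ^ s₀ i = algebraMap F (AlgebraicClosure F) (a i))
    (hdeg : IntermediateField.relfinrank
      (IntermediateField.adjoin F {ζ₀}) (radicalField F ζ₀ α₀) = p ^ ∑ i, s₀ i)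
    -- arbitrary exponents `(r, s)`
    (r : ℕ) (hr : 1 ≤ r) (s : Fin n → ℕ) (hs : ∀ i, s₀ i = 0 → s i = 0)
    (ζ : AlgebraicClosure F) (hζ : IsPrimitiveRoot ζ (p ^ r))
    (α : Fin n → AlgebraicClosure F)
    (hα : ∀ i, α i ^ p ^ s i = algebraMap F (AlgebraicClosure F) (a i)) :
    IsTotallyRamifiedOver p F (radicalField F ζ α) ∧
      HasRamificationIndex (LocalIntegers ℤ_[p] F) (radicalField F ζ α)
        ((p - 1) * p ^ (r - 1 + ∑ i, s i)) := by
  have := charZero_of_algebra_padic p F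
  have hpp : p.Prime := Fact.out
  have : CharZero (AlgebraicClosure F) :=
    charZero_of_injective_algebraMap (algebraMap F (AlgebraicClosure F)).injective
  obtain ⟨k, rfl⟩ : ∃ k, r = k + 1 := ⟨r - 1, by omega⟩
  obtain ⟨k₀, rfl⟩ : ∃ k₀, r₀ = k₀ + 1 := ⟨r₀ - 1, by omega⟩
  -- The sum is a convenient bound for every `s i`; thus `k + m + 1` dominates both `r` and all `s
  -- i`.
  set m := ∑ i, s i
  have hsm (i) : s i ≤ k + m + 1 :=
    (Finset.single_le_sum (f := s) (fun _ _ ↦ Nat.zero_le _) (Finset.mem_univ i)).trans (by omega)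
  have : NeZero (p ^ (k + m + 1)) := ⟨(pow_pos hpp.pos _).ne'⟩
  obtain ⟨ξ, hξ⟩ := HasEnoughRootsOfUnity.exists_primitiveRoot (AlgebraicClosure F)
      (p ^ (k + m + 1))
  have ha (i) : algebraMap F (AlgebraicClosure F) (a i) ∈
      (⊥ : IntermediateField F (AlgebraicClosure F)) :=
    IntermediateField.algebraMap_mem _ _
  have hbot (i) (hi : i ∉ Finset.univ.filter fun i ↦ 1 ≤ s₀ i) :
      α₀ i ∈ (⊥ : IntermediateField F (AlgebraicClosure F)) := by
    have h0 : s₀ i = 0 := by simpa using hi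
    have h1 := hα₀ i
    rw [h0, pow_zero, pow_one] at h1
    rw [h1]
    exact ha i
  have hind : PowIndependent p (⊥ : IntermediateField F (AlgebraicClosure F))
      (fun i ↦ algebraMap F _ (a i))
      (Finset.univ.filter fun i ↦ 1 ≤ s i) := by
    refine (powIndependent_of_relfinrank_eq (E := F⟮ζ₀⟯) (S := Finset.univ.filter fun i ↦ 1 ≤ s₀ i)
      (hζ₀.pow (pow_pos hpp.pos _) (pow_succ ..)) (pow_mem (mem_adjoin_simple_self F ζ₀) _)
      (fun i hi ↦ (Finset.mem_filter.mp hi).2) (fun i _ ↦ hα₀ i)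
      (fun i _ ↦ (bot_le : _ ≤ F⟮ζ₀⟯) (ha i)) ?_).mono bot_le fun i hi ↦ ?_
    · rw [← radicalField_eq_sup _ hbot, hdeg]
      congr 1
      exact (Finset.sum_filter_of_ne fun i _ hi ↦ Nat.one_le_iff_ne_zero.mpr hi).symm
    · have := hs i
      simp only [Finset.mem_filter, Finset.mem_univ, true_and] at hi ⊢
      omega
  have hfin := finrank_radicalField hF hp hζ ha hα hind hξ hsm
  have hram : IsTotallyRamifiedOver p F (radicalField F ζ α) := by
    -- `F(ζ, α)` need not be Galois over `F`, so total ramification is proved for `F(ξ, α)` and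
    -- inherited.
    refine IsTotallyRamifiedOver.of_le (M := radicalField F ξ α) ?_
      (hF.isTotallyRamifiedOver_radicalField hp hξ fun i ↦ ?_)
    · rw [radicalField, adjoin_le_iff]
      rintro x (hx | hx)
      · obtain ⟨j, -, hj⟩ := hξ.exists_pow_mul_eq_of_pow_eq (x := ζ) (y := 1) (pow_pos hpp.pos _)
          (by
          rw [show k + m + 1 = k + 1 + m by ring, pow_add, pow_mul, hζ.pow_eq_one, one_pow,
              one_pow])
        rw [hx, hj, mul_one]
        exact pow_mem (subset_adjoin F _ (Set.mem_insert ..)) j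
      · exact subset_adjoin F _ (Set.mem_insert_of_mem _ hx)
    · rw [← Nat.sub_add_cancel (hsm i), add_comm, pow_add, pow_mul, hα i]
      exact pow_mem (ha i) _
  refine ⟨hram, ?_⟩
  have : (p - 1) * p ^ (k + 1 - 1 + m) = finrank F (radicalField F ζ α) := by
    rw [hfin, Nat.totient_prime_pow_succ hpp, Nat.add_sub_cancel, pow_add]
    ring
  rw [this]
  exact hram
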